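/- **Conventions.** A quantale here is a complete lattice $A$ (with least element $0$ and greatest element $1$) together with a commutative associative multiplication that distributes over arbitrary joins and has $1$ as unit. Let $K(A)$ be the set of compact elements of $A$. $A$ is *coherent* if every element is a join of compact elements, $1\in K(A)$, and $K(A)$ is closed under multiplication. Write $a^{\perp}=\bigvee\{x\in A : ax=0\}$, and let $B(A)$ be the set of complemented elements of $A$. An element $p<1$ is *$m$-prime* if $ab\le p$ implies $a\le p$ or $b\le p$; $\mathrm{Spec}(A)$ is the set of $m$-prime elements and $\mathrm{Min}(A)$ the set of its minimal elements. $A$ is *semiprime* if $\bigwedge \mathrm{Spec}(A)=0$. For $a\in A$ put $V(a)=\{p\in \mathrm{Spec}(A): a\le p\}$. $\mathrm{Min}_Z(A)$ is $\mathrm{Min}(A)$ with the topology induced by the topology on $\mathrm{Spec}(A)$ whose closed sets are the $V(a)$, $a\in A$; $\mathrm{Spec}_F(A)$ is $\mathrm{Spec}(A)$ with the flat topology, which has the sets $V(c)$, $c\in K(A)$, as a basis of open sets. An element $a$ is *pure* if $a\vee c^{\perp}=1$ for all $c\in K(A)$ with $c\le a$. $A$ is a *$PP$-quantale* if $c^{\perp}\in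 B(A)$ for all $c\in K(A)$; a *$PF$-quantale* if $c^{\perp}$ is pure for all $c\in K(A)$; an *$mp$-quantale* if for every $p\in\mathrm{Spec}(A)$ there is a unique $q\in \mathrm{Min}(A)$ with $q\le p$. The *reticulation* $L(A)$ of a coherent quantale $A$ is the bounded distributive lattice, unique up to isomorphism, for which there is a surjection $\lambda:K(A)\to L(A)$ with $\lambda(a\vee b)\le\lambda(a)\vee\lambda(b)$, $\lambda(ab)=\lambda(a)\wedge\lambda(b)$, and $\lambda(a)\le\lambda(b)$ iff $a^n\le b$ for some integer $n\ge 1$. For a bounded distributive lattice $L$, $\mathrm{Min}_{Id,Z}(L)$ is the set of minimal prime ideals of $L$ with the topology induced by the Stone topology on the set of prime ideals (basis of open sets $\{P : x\notin P\}$, $x\in L$). $L$ is a *Stone lattice* if for every $x\in L$ there is a complemented $e\in L$ with $\{y\in L: x\wedge y=0\}=\{y\in L : y\le e\}$; $L$ is *conormal* if $x\wedge y=0$ implies that there are $u,v\in L$ with $x\wedge u=y\wedge v=0$ and $u\vee v=1$. A *Boolean space* is a compact, Hausdorff, totally disconnected space; a space is *normal* if disjoint closed sets have disjoint open neighbourhoods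 (no separation axiom for points is required). **Theorem.** Let $A$ be a semiprime coherent quantale. The following are equivalent: 1. $A$ is a $PP$-quantale; 2. $L(A)$ is a Stone lattice; 3. $L(A)$ is conormal and $\mathrm{Min}_{Id,Z}(L(A))$ is compact; 4. $A$ is a $PF$-quantale and $\mathrm{Min}_Z(A)$ is compact; 5. $A$ is a $PF$-quantale and $\mathrm{Min}_Z(A)$ is a Boolean space; 6. $A$ is an $mp$-quantale and $\mathrm{Min}_Z(A)$ is a Boolean space; 7. $\mathrm{Spec}_F(A)$ is a normal space and $\mathrm{Min}_Z(A)$ is a Boolean space. -/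

import Mathlib

set_option linter.unusedSectionVars false

universe u v

namespace CohQuantale

section QuantaleNotions

variable (A : Type u) [CommMonoid A] [CompleteLattice A] [IsQuantale A]

/-- A coherent (integral, commutative) quantale: the unit of the multiplication is the top
element, every element is a join of compact elements, the top element is compact, and the compact
elements are closed under multiplication. -/
class IsCoherent : Prop extends IsCompactlyGenerated A where
  one_eq_top : (1 : A) = ⊤
  isCompact_top : IsCompactElement (⊤ : A)
  isCompact_mul : ∀ a b : A, IsCompactElement a → IsCompactElement b → IsCompactElement (a * b)

/-- The set `K(A)` of compact elements, as a type. -/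
def K : Type u := {c : A // IsCompactElement c}

variable {A}

/-- The `m`-prime elements. -/
def IsMPrime (p : A) : Prop :=
  p < ⊤ ∧ ∀ a b : A, a * b ≤ p → a ≤ p ∨ b ≤ p

/-- The minimal `m`-prime elements. -/
def IsMinimalMPrime (p : A) : Prop := Minimal IsMPrime p

/-- The radical `ρ(a)`: the meet of all `m`-prime elements above `a`. -/
def radical (a : A) : A := sInf {p : A | IsMPrime p ∧ a ≤ p}

/-- The annihilator `a^⊥`: the join of all `x` with `a x = 0`. -/
def perp (a : A) : A := sSup {x : A | a * x = ⊥}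

/-- Pure elements. -/
def IsPure (a : A) : Prop :=
  ∀ c : A, IsCompactElement c → c ≤ a → a ⊔ perp c = ⊤

variable (A)

def IsSemiprime : Prop := radical (⊥ : A) = ⊥

/-- `PP`-quantales: `c^⊥` is complemented for every compact `c`. -/
def IsPP : Prop := ∀ c : A, IsCompactElement c → IsComplemented (perp c)

/-- `PF`-quantales: `c^⊥` is pure for every compact `c`. -/
def IsPF : Prop := ∀ c : A, IsCompactElement c → IsPure (perp c)

/-- `mp`-quantales: below every `m`-prime element there is exactly one minimal `m`-prime
element. -/
def IsMP : Prop := ∀ p : A, IsMPrime p → ∃! q : A, IsMinimalMPrime q ∧ q ≤ p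

end QuantaleNotions

section Auxiliary

variable {A : Type u} [CommMonoid A] [CompleteLattice A] [IsQuantale A] [IsCoherent A]

theorem le_one' (a : A) : a ≤ 1 := by
  rw [IsCoherent.one_eq_top]; exact le_top

theorem mul_le_left' (a b : A) : a * b ≤ a := by
  calc a * b ≤ a * 1 := mul_le_mul_right (le_one' b) a
    _ = a := mul_one a

theorem mul_le_right' (a b : A) : a * b ≤ b := by
  rw [mul_comm]; exact mul_le_left' b a

theorem sup_pow_le (a b : A) (n m : ℕ) : (a ⊔ b) ^ (n + m) ≤ a ^ n ⊔ b ^ m := by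
  induction n generalizing m with
  | zero => rw [pow_zero]; exact (le_one' _).trans le_sup_left
  | succ n ihn =>
    induction m with
    | zero => rw [pow_zero]; exact (le_one' _).trans le_sup_right
    | succ m ihm =>
      have h1 : (a ⊔ b) ^ (n + (m + 1)) * a ≤ a ^ (n + 1) ⊔ b ^ (m + 1) := by
        refine (mul_le_mul_left (ihn (m + 1)) a).trans ?_
        rw [Quantale.sup_mul_distrib, ← pow_succ]
        exact sup_le_sup le_rfl (mul_le_left' _ _)
      have h2 : (a ⊔ b) ^ (n + 1 + m) * b ≤ a ^ (n + 1) ⊔ b ^ (m + 1) := by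
        refine (mul_le_mul_left ihm b).trans ?_
        rw [Quantale.sup_mul_distrib, ← pow_succ]
        exact sup_le_sup (mul_le_left' _ _) le_rfl
      have e : (a ⊔ b) ^ (n + 1 + (m + 1)) = (a ⊔ b) ^ (n + (m + 1)) * (a ⊔ b) := by
        rw [← pow_succ]; congr 1; omega
      have e2 : n + (m + 1) = n + 1 + m := by omega
      rw [e, Quantale.mul_sup_distrib]
      exact sup_le h1 (e2 ▸ h2)

theorem isCompact_bot : IsCompactElement (⊥ : A) := by
  simpa using CompleteLattice.isCompactElement_finsetSup (α := A) (f := id) ∅ (by simp)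

theorem isCompact_sup {a b : A} (ha : IsCompactElement a) (hb : IsCompactElement b) :
    IsCompactElement (a ⊔ b) := by
  classical
  simpa using CompleteLattice.isCompactElement_finsetSup (α := A) (f := id) {a, b} (by simp [ha, hb])

end Auxiliary

section Spectra

variable (A : Type u) [CommMonoid A] [CompleteLattice A] [IsQuantale A]

/-- The set `Spec(A)` of `m`-prime elements, carrying the spectral (Zariski) topology. -/
def SpecZ : Type u := {p : A // IsMPrime p}

/-- The set `Spec(A)` of `m`-prime elements, carrying the flat topology. -/
def SpecF : Type u := {p : A // IsMPrime p}

/-- The topology whose closed sets are exactly the sets `V(a) = {p | a ≤ p}` with `a ∈ A`. -/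
instance [IsCoherent A] : TopologicalSpace (SpecZ A) :=
  TopologicalSpace.ofClosed (Set.range fun a : A => {p : SpecZ A | a ≤ p.1})
    ⟨⊤, by
      ext p
      simp only [Set.mem_ofPred_eq, Set.mem_empty_iff_false, iff_false]
      exact fun h => not_lt_of_ge h p.2.1⟩
    (by
      intro S hS
      refine ⟨sSup {a : A | {p : SpecZ A | a ≤ p.1} ∈ S}, ?_⟩
      ext p
      simp only [Set.mem_ofPred_eq, sSup_le_iff, Set.mem_sInter]
      constructor
      · intro h t ht
        obtain ⟨a, rfl⟩ := hS ht
        exact h a ht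
      · intro h a ha
        exact h _ ha)
    (by
      rintro _ ⟨a, rfl⟩ _ ⟨b, rfl⟩
      refine ⟨a * b, ?_⟩
      ext p
      simp only [Set.mem_ofPred_eq, Set.mem_union]
      constructor
      · exact p.2.2 a b
      · rintro (h | h)
        · exact (mul_le_left' a b).trans h
        · exact (mul_le_right' a b).trans h)

/-- The flat topology: the sets `V(c) = {p | c ≤ p}` with `c` compact form a basis of open sets
(they are closed under finite intersections, as `V(c) ∩ V(d) = V(c ⊔ d)` and
`V(⊥)` is everything). -/
instance : TopologicalSpace (SpecF A) :=
  TopologicalSpace.generateFrom {U | ∃ c : A, IsCompactElement c ∧ U = {p : SpecF A | c ≤ p.1}}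

/-- The set `Min(A)` of minimal `m`-prime elements, as a subspace of `SpecZ A`. -/
abbrev MinZ : Type u := {p : SpecZ A // IsMinimalMPrime p.1}

end Spectra

/-- Boolean (Stone) spaces: compact, Hausdorff and totally disconnected. -/
def IsBooleanSpace (X : Type u) [TopologicalSpace X] : Prop :=
  CompactSpace X ∧ T2Space X ∧ TotallyDisconnectedSpace X

section Lattices

variable (L : Type u) [DistribLattice L] [BoundedOrder L]

/-- Stone lattices: the annihilator `{y | x ⊓ y = 0}` of every element `x` is the principal ideal
generated by a complemented element. -/
def IsStoneLattice : Prop :=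
  ∀ x : L, ∃ e : L, IsComplemented e ∧ {y : L | x ⊓ y = ⊥} = Set.Iic e

/-- Conormal lattices. -/
def IsConormalLattice : Prop :=
  ∀ x y : L, x ⊓ y = ⊥ → ∃ s t : L, x ⊓ s = ⊥ ∧ y ⊓ t = ⊥ ∧ s ⊔ t = ⊤

/-- The set of prime ideals of a bounded distributive lattice, carrying the Stone topology. -/
def SpecIdZ : Type u := {P : Order.Ideal L // P.IsPrime}

/-- The Stone topology: the sets `{P | x ∉ P}` with `x ∈ L` form a basis of open sets. -/
instance : TopologicalSpace (SpecIdZ L) :=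
  TopologicalSpace.generateFrom {U | ∃ x : L, U = {P : SpecIdZ L | x ∉ P.1}}

/-- The set of minimal prime ideals, as a subspace of `SpecIdZ L`. -/
abbrev MinIdZ : Type u :=
  {P : SpecIdZ L // Minimal (fun I : Order.Ideal L => I.IsPrime) P.1}

end Lattices

section Reticulation

variable (A : Type u) [CommMonoid A] [CompleteLattice A] [IsQuantale A] [IsCoherent A]

/-- The preorder on `K(A)` with `a ≼ b` iff `a ^ n ≤ b` for some `n ≥ 1`. -/
def ReticLE (a b : K A) : Prop := ∃ n : ℕ, 1 ≤ n ∧ a.1 ^ n ≤ b.1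

variable {A}

theorem ReticLE.of_le {a b : K A} (h : a.1 ≤ b.1) : ReticLE A a b :=
  ⟨1, le_rfl, by rwa [pow_one]⟩

theorem ReticLE.trans {a b c : K A} : ReticLE A a b → ReticLE A b c → ReticLE A a c := by
  rintro ⟨n, hn, h⟩ ⟨m, hm, h'⟩
  refine ⟨n * m, Nat.mul_pos hn hm, ?_⟩
  rw [pow_mul]
  exact (pow_le_pow_left' h m).trans h'

/-- The binary join on `K(A)`. -/
def K.sup (a b : K A) : K A := ⟨a.1 ⊔ b.1, isCompact_sup a.2 b.2⟩

/-- The multiplication on `K(A)`. -/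
def K.mul (a b : K A) : K A := ⟨a.1 * b.1, IsCoherent.isCompact_mul _ _ a.2 b.2⟩

theorem ReticLE.sup_le {a b c : K A} : ReticLE A a c → ReticLE A b c → ReticLE A (a.sup b) c := by
  rintro ⟨n, hn, h⟩ ⟨m, _, h'⟩
  exact ⟨n + m, by omega, (sup_pow_le a.1 b.1 n m).trans (_root_.sup_le h h')⟩

theorem ReticLE.le_mul {a b c : K A} : ReticLE A a b → ReticLE A a c → ReticLE A a (b.mul c) := by
  rintro ⟨n, hn, h⟩ ⟨m, _, h'⟩
  refine ⟨n + m, by omega, ?_⟩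
  rw [pow_add]
  exact mul_le_mul' h h'

variable (A)

/-- Two compact elements are identified when each lies above a positive power of the other. -/
def reticSetoid : Setoid (K A) where
  r a b := ReticLE A a b ∧ ReticLE A b a
  iseqv :=
    ⟨fun _ => ⟨.of_le le_rfl, .of_le le_rfl⟩, fun h => ⟨h.2, h.1⟩,
      fun h h' => ⟨h.1.trans h'.1, h'.2.trans h.2⟩⟩

/-- The reticulation `L(A)` of a coherent quantale. -/
def Retic : Type u := Quotient (reticSetoid A)

variable {A}

/-- The canonical map `λ : K(A) → L(A)`. -/
def lam (c : K A) : Retic A := Quotient.mk (reticSetoid A) c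

instance : LE (Retic A) where
  le := Quotient.lift₂ (ReticLE A) (fun _ _ _ _ h h' => propext
    ⟨fun k => (h.2.trans k).trans h'.1, fun k => (h.1.trans k).trans h'.2⟩)

theorem lam_le_lam {a b : K A} : lam a ≤ lam b ↔ ReticLE A a b := Iff.rfl

instance : PartialOrder (Retic A) where
  le_refl x := Quotient.inductionOn x fun _ => ReticLE.of_le le_rfl
  le_trans x y z := Quotient.inductionOn₃ x y z fun _ _ _ h h' => ReticLE.trans h h'
  le_antisymm x y := Quotient.inductionOn₂ x y fun _ _ h h' => Quotient.sound ⟨h, h'⟩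

instance : Lattice (Retic A) where
  sup := Quotient.map₂ K.sup (fun _ _ h _ _ h' =>
    ⟨.sup_le (h.1.trans (.of_le le_sup_left)) (h'.1.trans (.of_le le_sup_right)),
      .sup_le (h.2.trans (.of_le le_sup_left)) (h'.2.trans (.of_le le_sup_right))⟩)
  le_sup_left x y := Quotient.inductionOn₂ x y fun _ _ => ReticLE.of_le le_sup_left
  le_sup_right x y := Quotient.inductionOn₂ x y fun _ _ => ReticLE.of_le le_sup_right
  sup_le x y z := Quotient.inductionOn₃ x y z fun _ _ _ h h' => ReticLE.sup_le h h'
  inf := Quotient.map₂ K.mul (fun _ _ h _ _ h' =>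
    ⟨.le_mul (.trans (.of_le (mul_le_left' _ _)) h.1) (.trans (.of_le (mul_le_right' _ _)) h'.1),
      .le_mul (.trans (.of_le (mul_le_left' _ _)) h.2)
        (.trans (.of_le (mul_le_right' _ _)) h'.2)⟩)
  inf_le_left x y := Quotient.inductionOn₂ x y fun _ _ => ReticLE.of_le (mul_le_left' _ _)
  inf_le_right x y := Quotient.inductionOn₂ x y fun _ _ => ReticLE.of_le (mul_le_right' _ _)
  le_inf x y z := Quotient.inductionOn₃ x y z fun _ _ _ h h' => ReticLE.le_mul h h'

theorem lam_sup (a b : K A) : lam (a.sup b) = lam a ⊔ lam b := rfl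

theorem lam_mul (a b : K A) : lam (a.mul b) = lam a ⊓ lam b := rfl

instance : DistribLattice (Retic A) where
  le_sup_inf x y z := Quotient.inductionOn₃ x y z fun a b c => ReticLE.of_le (by
    change (a.1 ⊔ b.1) * (a.1 ⊔ c.1) ≤ a.1 ⊔ b.1 * c.1
    rw [Quantale.mul_sup_distrib, Quantale.sup_mul_distrib, Quantale.sup_mul_distrib]
    exact _root_.sup_le (_root_.sup_le ((mul_le_left' _ _).trans le_sup_left)
        ((mul_le_right' _ _).trans le_sup_left))
      (_root_.sup_le ((mul_le_left' _ _).trans le_sup_left) le_sup_right))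

instance : BoundedOrder (Retic A) where
  top := lam ⟨⊤, IsCoherent.isCompact_top⟩
  le_top x := Quotient.inductionOn x fun _ => ReticLE.of_le le_top
  bot := lam ⟨⊥, isCompact_bot⟩
  bot_le x := Quotient.inductionOn x fun _ => ReticLE.of_le bot_le

/-- The axiomatic notion: a reticulation of `A` is a bounded distributive lattice `L` with a
surjection `f : K(A) → L` having the following three properties. -/
structure IsReticulation {L : Type v} [DistribLattice L] [BoundedOrder L] (f : K A → L) :
    Prop where
  surjective : Function.Surjective f
  map_sup_le : ∀ a b : K A, f (a.sup b) ≤ f a ⊔ f b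
  map_mul : ∀ a b : K A, f (a.mul b) = f a ⊓ f b
  map_le_map_iff : ∀ a b : K A, f a ≤ f b ↔ ∃ n : ℕ, 1 ≤ n ∧ a.1 ^ n ≤ b.1

/-- `L(A)` with `λ` is a reticulation of `A`. -/
theorem isReticulation_lam : IsReticulation (lam : K A → Retic A) where
  surjective := Quotient.mk_surjective
  map_sup_le _ _ := le_rfl
  map_mul _ _ := rfl
  map_le_map_iff _ _ := Iff.rfl

/-- Reticulations are unique: every reticulation is isomorphic to `L(A)`, compatibly with the
maps from `K(A)`. -/
theorem IsReticulation.exists_orderIso {L : Type v} [DistribLattice L] [BoundedOrder L]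
    {f : K A → L} (hf : IsReticulation f) : ∃ e : Retic A ≃o L, ∀ c : K A, e (lam c) = f c := by
  have hle : ∀ a b : K A, f a ≤ f b ↔ lam a ≤ lam b := fun a b => hf.map_le_map_iff a b
  let g : Retic A → L := Quotient.lift f fun a b h =>
    le_antisymm ((hle a b).2 h.1) ((hle b a).2 h.2)
  have hg : ∀ x y : Retic A, g x ≤ g y ↔ x ≤ y := fun x y =>
    Quotient.inductionOn₂ x y fun a b => hle a b
  have hs : Function.Surjective g := fun y => by
    obtain ⟨c, hc⟩ := hf.surjective y
    exact ⟨lam c, hc⟩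
  exact ⟨RelIso.ofSurjective (OrderEmbedding.ofMapLEIff g hg) hs, fun _ => rfl⟩

end Reticulation

end CohQuantale

namespace CohQuantale

/-! ### Annihilators, `m`-prime elements and minimal `m`-primes. -/

section Quantale

variable {A : Type u} [CommMonoid A] [CompleteLattice A] [IsQuantale A]

/-! The pivot is that, for `A` semiprime and `c` compact, a minimal `m`-prime lies above exactly one
of `c` and `c^⊥` (`IsMinimalMPrime.le_iff_not_perp_le`). Hence each `V(c)` is clopen in `Min_Z(A)`,
so that this space is Hausdorff and totally disconnected, and being Boolean only means being
compact. The same localisation argument shows that PF and mp agree.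

PF says that `cd = 0` forces `c^⊥ ∨ d^⊥ = 1`. If moreover `Min_Z(A)` is compact, one compact `d`
with `cd = 0` serves all minimal `m`-primes above `c`, and `d^⊥` complements `c^⊥`. Conversely,
under PP the map sending an `m`-prime to a minimal one below it is continuous for the spectral and
the flat topology alike. The first makes `Min_Z(A)` compact, as an image of `Spec(A)`; the second
pulls normality of `Min_Z(A)` back to `Spec_F(A)`. Normality of `Spec_F(A)` in turn gives mp, since
flat open sets are upward closed and minimal `m`-primes are flat-closed points.

The lattice conditions translate through `λ`: without nilpotents, `λ(c) ∧ λ(d) = 0` iff `cd = 0`,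
and the spectra of `A` and `L(A)` are homeomorphic by an order isomorphism. -/

theorem le_perp_iff {a x : A} : x ≤ perp a ↔ a * x = ⊥ := by
  refine ⟨fun h => ?_, fun h => le_sSup h⟩
  rw [← le_bot_iff]
  refine (mul_le_mul_right h a).trans ?_
  rw [perp, mul_sSup_distrib]
  exact iSup₂_le fun y hy => le_of_eq hy

theorem mul_perp (a : A) : a * perp a = ⊥ := le_perp_iff.1 le_rfl

theorem IsMPrime.le_of_pow_le {p a : A} (hp : IsMPrime p) {n : ℕ} (hn : 1 ≤ n) (h : a ^ n ≤ p) :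
    a ≤ p := by
  induction n, hn using Nat.le_induction with
  | base => rwa [pow_one] at h
  | succ n _ ih =>
    rw [pow_succ] at h
    exact (hp.2 _ _ h).elim ih id

theorem IsMPrime.perp_le {p a : A} (hp : IsMPrime p) (h : ¬ a ≤ p) : perp a ≤ p :=
  (hp.2 a (perp a) ((mul_perp a).trans_le bot_le)).resolve_left h

theorem IsSemiprime.eq_bot_of_pow_eq_bot (hA : IsSemiprime A) {a : A} {n : ℕ} (hn : 1 ≤ n)
    (h : a ^ n = ⊥) : a = ⊥ := by
  rw [← le_bot_iff, ← show radical (⊥ : A) = ⊥ from hA]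
  exact le_sInf fun p hp => hp.1.le_of_pow_le hn (h.trans_le bot_le)

/-- The meet of a nonempty chain of `m`-prime elements is `m`-prime. -/
theorem isMPrime_sInf_of_isChain {s : Set A} (hs : ∀ p ∈ s, IsMPrime p) (hc : IsChain (· ≤ ·) s)
    (hne : s.Nonempty) : IsMPrime (sInf s) := by
  obtain ⟨p₀, hp₀⟩ := hne
  refine ⟨(sInf_le hp₀).trans_lt (hs _ hp₀).1, fun a b hab => ?_⟩
  by_contra! h
  simp only [le_sInf_iff, not_forall] at h
  obtain ⟨⟨p, hp, hap⟩, q, hq, hbq⟩ := h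
  obtain ⟨r, hr, hrp, hrq⟩ : ∃ r ∈ s, r ≤ p ∧ r ≤ q := by
    rcases hc.total hp hq with h | h
    · exact ⟨p, hp, le_rfl, h⟩
    · exact ⟨q, hq, h, le_rfl⟩
  rcases (hs r hr).2 a b (hab.trans (sInf_le hr)) with h | h
  · exact hap (h.trans hrp)
  · exact hbq (h.trans hrq)

theorem IsMPrime.exists_isMinimalMPrime_le {p : A} (hp : IsMPrime p) :
    ∃ q, IsMinimalMPrime q ∧ q ≤ p := by
  obtain ⟨q, hqp, hq⟩ := zorn_le_nonempty₀ (α := Aᵒᵈ) {x | IsMPrime (OrderDual.ofDual x)}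
    (fun c hc hch y hy => ⟨OrderDual.toDual (sInf (OrderDual.toDual ⁻¹' c)),
      isMPrime_sInf_of_isChain (fun x hx => hc hx)
        (fun a ha b hb hab => (hch ha hb hab).symm) ⟨_, hy⟩,
      fun z hz => sInf_le (a := OrderDual.ofDual z) hz⟩) (OrderDual.toDual p) hp
  exact ⟨OrderDual.ofDual q, ⟨hq.1, fun y hy hyq => hq.2 hy hyq⟩, hqp⟩

end Quantale

/-! ### Prime avoidance, PF and mp, complemented elements. -/

section Coherent

variable {A : Type u} [CommMonoid A] [CompleteLattice A] [IsQuantale A] [IsCoherent A]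

/-- The prime element theorem: an element lying above no member of a multiplicatively closed set
of compact elements lies below an `m`-prime element with the same property. -/
theorem exists_isMPrime_of_forall_not_le {S : Set A} (hS : ∀ s ∈ S, IsCompactElement s)
    (hmul : ∀ s ∈ S, ∀ t ∈ S, s * t ∈ S) (hne : S.Nonempty) {a : A} (ha : ∀ s ∈ S, ¬ s ≤ a) :
    ∃ p, IsMPrime p ∧ a ≤ p ∧ ∀ s ∈ S, ¬ s ≤ p := by
  obtain ⟨p, hap, hp⟩ := zorn_le_nonempty₀ {x : A | ∀ s ∈ S, ¬ s ≤ x}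
    (fun c hc hch y hy => ⟨sSup c, fun s hs hle => by
      obtain ⟨x, hx, hsx⟩ := (CompleteLattice.isCompactElement_iff_le_of_directed_sSup_le A s).1
        (hS s hs) c ⟨y, hy⟩ hch.directedOn hle
      exact hc hx s hs hsx, fun z hz => le_sSup hz⟩) a ha
  refine ⟨p, ⟨lt_top_iff_ne_top.2 ?_, fun x y hxy => ?_⟩, hap, hp.1⟩
  · rintro rfl
    obtain ⟨s, hs⟩ := hne
    exact hp.1 s hs le_top
  · by_contra! h
    -- By maximality of `p`, any strictly larger element lies above a member of `S`; since `xy ≤ p`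
    -- gives `(p ∨ x)(p ∨ y) ≤ p`, two such members multiply to one below `p`.
    have key : ∀ z : A, ¬ z ≤ p → ∃ s ∈ S, s ≤ p ⊔ z := fun z hz => by
      by_contra! hz'
      exact hz (le_sup_right.trans (hp.2 (y := p ⊔ z) hz' le_sup_left))
    obtain ⟨s, hs, hsx⟩ := key x h.1
    obtain ⟨t, ht, hty⟩ := key y h.2
    refine hp.1 _ (hmul s hs t ht) ((mul_le_mul' hsx hty).trans ?_)
    rw [Quantale.mul_sup_distrib, Quantale.sup_mul_distrib, Quantale.sup_mul_distrib]
    exact sup_le (sup_le (mul_le_left' _ _) (mul_le_right' _ _)) (sup_le (mul_le_left' _ _) hxy)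

theorem exists_isMPrime_ge {a : A} (ha : a ≠ ⊤) : ∃ p, IsMPrime p ∧ a ≤ p := by
  obtain ⟨p, hp, hap, -⟩ := exists_isMPrime_of_forall_not_le (S := {(⊤ : A)})
    (by simpa using IsCoherent.isCompact_top)
    (by simp [← IsCoherent.one_eq_top (A := A)]) ⟨_, rfl⟩ (a := a) (by simpa using ha)
  exact ⟨p, hp, hap⟩

theorem isCompact_pow {c : A} (hc : IsCompactElement c) (n : ℕ) : IsCompactElement (c ^ n) := by
  induction n with
  | zero => rw [pow_zero, IsCoherent.one_eq_top]; exact IsCoherent.isCompact_top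
  | succ n ih => rw [pow_succ]; exact IsCoherent.isCompact_mul _ _ ih hc

theorem IsMPrime.mul_not_le {p a b : A} (hp : IsMPrime p) (ha : ¬ a ≤ p) (hb : ¬ b ≤ p) :
    ¬ a * b ≤ p := fun h => (hp.2 a b h).elim ha hb

theorem exists_compact_le_not_le {a b : A} (h : ¬ a ≤ b) :
    ∃ c, IsCompactElement c ∧ c ≤ a ∧ ¬ c ≤ b := by
  by_contra! h'
  exact h (le_iff_compact_le_imp.2 h')

/-- `(ab)^(n+1) ≤ a^n b`, and there are no nonzero nilpotents. This removes the powers that come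
with the order of the reticulation. -/
theorem mul_eq_bot_of_pow_mul_eq_bot (hA : IsSemiprime A) {a b : A} (n : ℕ)
    (h : a ^ n * b = ⊥) : a * b = ⊥ := by
  refine hA.eq_bot_of_pow_eq_bot (n := n + 1) (by omega) ?_
  rw [mul_pow, pow_succ b n, ← le_bot_iff, ← h]
  exact mul_le_mul' (by rw [pow_succ]; exact mul_le_left' _ _) (mul_le_right' _ _)

/-- If an `m`-prime element lies above `c^⊥`, then some minimal `m`-prime element below it does not
lie above `c`. -/
theorem exists_isMinimalMPrime_not_le (hA : IsSemiprime A) {c p : A} (hc : IsCompactElement c)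
    (hp : IsMPrime p) (h : perp c ≤ p) : ∃ q, IsMinimalMPrime q ∧ q ≤ p ∧ ¬ c ≤ q := by
  have htop : ¬ (1 : A) ≤ p := fun h1 =>
    hp.1.ne (top_le_iff.1 (IsCoherent.one_eq_top (A := A) ▸ h1))
  -- Localise at `p` and invert `c`: the set of all `c^n t` with `t` compact and not below `p`
  -- avoids `0`, because `c^n t = 0` would give `t ≤ c^⊥ ≤ p`. Taking `n = 0` puts the resulting
  -- `m`-prime below `p`; taking `t = 1` keeps `c` out of it.
  obtain ⟨q, hq, -, hqS⟩ := exists_isMPrime_of_forall_not_le (a := (⊥ : A))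
    (S := {s | ∃ n : ℕ, ∃ t : A, IsCompactElement t ∧ ¬ t ≤ p ∧ s = c ^ n * t})
    (by
      rintro _ ⟨n, t, ht, -, rfl⟩
      exact IsCoherent.isCompact_mul _ _ (isCompact_pow hc n) ht)
    (by
      rintro _ ⟨n, t, ht, htp, rfl⟩ _ ⟨m, s, hs, hsp, rfl⟩
      exact ⟨n + m, t * s, IsCoherent.isCompact_mul _ _ ht hs, hp.mul_not_le htp hsp, by
        rw [pow_add, mul_mul_mul_comm]⟩)
    ⟨1, 0, 1, by rw [IsCoherent.one_eq_top]; exact IsCoherent.isCompact_top, htop, by simp⟩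
    (by
      rintro _ ⟨n, t, ht, htp, rfl⟩ hle
      exact htp ((le_perp_iff.2 (mul_eq_bot_of_pow_mul_eq_bot hA n (le_bot_iff.1 hle))).trans h))
  obtain ⟨r, hr, hrq⟩ := hq.exists_isMinimalMPrime_le
  refine ⟨r, hr, hrq.trans (le_iff_compact_le_imp.2 fun t ht htq => ?_), fun hcr => ?_⟩
  · by_contra htp
    exact hqS t ⟨0, t, ht, htp, by simp⟩ htq
  · exact hqS c ⟨1, 1, by rw [IsCoherent.one_eq_top]; exact IsCoherent.isCompact_top, htop, by simp⟩
      (hcr.trans hrq)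

/-- A minimal `m`-prime element contains a compact element iff it does not contain its
annihilator. -/
theorem IsMinimalMPrime.le_iff_not_perp_le (hA : IsSemiprime A) {c p : A}
    (hc : IsCompactElement c) (hp : IsMinimalMPrime p) : c ≤ p ↔ ¬ perp c ≤ p := by
  refine ⟨fun hcp h => ?_, fun h => by_contra fun hcp => h (hp.1.perp_le hcp)⟩
  obtain ⟨q, hq, hqp, hcq⟩ := exists_isMinimalMPrime_not_le hA hc hp.1 h
  exact hcq (hcp.trans (hp.2 hq.1 hqp))

theorem eq_bot_of_forall_isMinimalMPrime (hA : IsSemiprime A) {a : A}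
    (h : ∀ p, IsMinimalMPrime p → a ≤ p) : a = ⊥ := by
  rw [← le_bot_iff, ← show radical (⊥ : A) = ⊥ from hA]
  refine le_sInf fun p hp => ?_
  obtain ⟨q, hq, hqp⟩ := hp.1.exists_isMinimalMPrime_le
  exact (h q hq).trans hqp

theorem isPF_iff : IsPF A ↔ ∀ c d : A, IsCompactElement c → IsCompactElement d → c * d = ⊥ →
    perp c ⊔ perp d = ⊤ :=
  ⟨fun h c d hc hd hcd => h c hc d hd (le_perp_iff.2 hcd),
    fun h c hc d hd hcd => h c d hc hd (le_perp_iff.1 hcd)⟩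

/-- Compactness is inherited from `1`: a directed cover of `e`, joined with `f`, covers `1`, and
multiplying by `e` then kills `f`. -/
theorem isCompact_of_sup_eq_top {e f : A} (hsup : e ⊔ f = ⊤) (hmul : e * f = ⊥) :
    IsCompactElement e := by
  rw [CompleteLattice.isCompactElement_iff_le_of_directed_sSup_le]
  intro s hs hd he
  obtain ⟨x, ⟨y, hy, rfl⟩, hx⟩ :=
    (CompleteLattice.isCompactElement_iff_le_of_directed_sSup_le A ⊤).1 IsCoherent.isCompact_top
      ((fun y => f ⊔ y) '' s) (hs.image _)
      (directedOn_image.2 (hd.mono' fun a _ b _ hab => sup_le_sup_left hab f))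
      (by
        rw [← hsup]
        refine sup_le (he.trans (sSup_le fun y hy => ?_)) ?_
        · exact le_sup_right.trans (le_sSup (Set.mem_image_of_mem _ hy))
        · obtain ⟨y, hy⟩ := hs
          exact le_sup_left.trans (le_sSup (Set.mem_image_of_mem _ hy)))
  refine ⟨y, hy, ?_⟩
  calc e = e * ⊤ := by rw [← IsCoherent.one_eq_top, mul_one]
    _ ≤ e * (f ⊔ y) := mul_le_mul_right hx e
    _ = e * y := by rw [Quantale.mul_sup_distrib, hmul, bot_sup_eq]
    _ ≤ y := mul_le_right' _ _

theorem mul_eq_bot_of_isCompl {e f : A} (h : IsCompl e f) : e * f = ⊥ :=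
  le_bot_iff.1 ((le_inf (mul_le_left' e f) (mul_le_right' e f)).trans h.inf_eq_bot.le)

theorem isCompl_of_mul_eq_bot (hA : IsSemiprime A) {e f : A} (hsup : e ⊔ f = ⊤)
    (hmul : e * f = ⊥) : IsCompl e f := by
  refine IsCompl.of_eq (hA.eq_bot_of_pow_eq_bot (n := 2) (by norm_num) ?_) hsup
  rw [sq, ← le_bot_iff, ← hmul]
  exact mul_le_mul' inf_le_left inf_le_right

theorem le_of_mul_eq_bot {a e f : A} (hsup : e ⊔ f = ⊤) (h : a * f = ⊥) : a ≤ e := by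
  calc a = a * (e ⊔ f) := by rw [hsup, ← IsCoherent.one_eq_top, mul_one]
    _ = a * e := by rw [Quantale.mul_sup_distrib, h, sup_bot_eq]
    _ ≤ e := mul_le_right' _ _

theorem IsPP.isPF (h : IsPP A) : IsPF A := by
  refine isPF_iff.2 fun c d hc _ hcd => ?_
  obtain ⟨f, hf⟩ := h c hc
  refine top_le_iff.1 (hf.sup_eq_top.ge.trans (sup_le_sup_left (le_perp_iff.2 ?_) _))
  rw [← le_bot_iff, ← mul_eq_bot_of_isCompl hf]
  exact mul_le_mul_left (le_perp_iff.2 hcd) f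

/-- Distinct minimal `q` and `r` are told apart by compact `c`, `d` with `cd = 0`, `c` not below `q`
and `d` not below `r`. Then `c^⊥ ≤ q` and `d^⊥ ≤ r`, so an `m`-prime above both would be above `1`.
-/
theorem IsPF.isMP (hA : IsSemiprime A) (h : IsPF A) : IsMP A := by
  intro p hp
  obtain ⟨q, hq, hqp⟩ := hp.exists_isMinimalMPrime_le
  refine ⟨q, ⟨hq, hqp⟩, fun r ⟨hr, hrp⟩ => ?_⟩
  by_contra hne
  have hrq : ¬ r ≤ q := fun hle => hne (le_antisymm hle (hq.2 hr.1 hle))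
  obtain ⟨c, hc, hcr, hcq⟩ := exists_compact_le_not_le hrq
  obtain ⟨d, hd, hdc, hdr⟩ := exists_compact_le_not_le ((hr.le_iff_not_perp_le hA hc).1 hcr)
  have := isPF_iff.1 h c d hc hd (le_perp_iff.1 hdc)
  exact hp.1.not_ge (this.ge.trans
    (sup_le ((hq.1.perp_le hcq).trans hqp) ((hr.1.perp_le hdr).trans hrp)))

/-- An `m`-prime above `c^⊥ ∨ d^⊥` has below it a minimal one missing `c` and a minimal one missing
`d`; if they coincide, primality contradicts `cd = 0`. -/
theorem IsMP.isPF (hA : IsSemiprime A) (h : IsMP A) : IsPF A := by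
  refine isPF_iff.2 fun c d hc hd hcd => ?_
  by_contra hne
  obtain ⟨p, hp, hle⟩ := exists_isMPrime_ge hne
  obtain ⟨q, hq, hqp, hcq⟩ :=
    exists_isMinimalMPrime_not_le hA hc hp (le_sup_left.trans hle)
  obtain ⟨r, hr, hrp, hdr⟩ :=
    exists_isMinimalMPrime_not_le hA hd hp (le_sup_right.trans hle)
  obtain rfl := (h p hp).unique ⟨hq, hqp⟩ ⟨hr, hrp⟩
  exact hq.1.mul_not_le hcq hdr (hcd.trans_le bot_le)

end Coherent

/-! ### Conormal and Stone reticulations. -/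

section Retic

variable {A : Type u} [CommMonoid A] [CompleteLattice A] [IsQuantale A] [IsCoherent A]

theorem exists_lam_eq (x : Retic A) : ∃ c : K A, lam c = x := Quotient.exists_rep x

theorem lam_eq_bot_iff (hA : IsSemiprime A) {c : K A} : lam c = ⊥ ↔ c.1 = ⊥ := by
  rw [← le_bot_iff]
  constructor
  · rintro ⟨n, hn, h⟩
    exact hA.eq_bot_of_pow_eq_bot hn (le_bot_iff.1 h)
  · exact fun h => ReticLE.of_le h.le

theorem lam_eq_top_iff {c : K A} : lam c = ⊤ ↔ c.1 = ⊤ := by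
  rw [← top_le_iff]
  constructor
  · rintro ⟨n, -, h⟩
    rw [← top_le_iff]
    refine le_trans (le_of_eq ?_) h
    change ⊤ = (⊤ : A) ^ n
    rw [← IsCoherent.one_eq_top, one_pow]
  · exact fun h => ReticLE.of_le h.ge

theorem lam_inf_lam_eq_bot_iff (hA : IsSemiprime A) {c d : K A} :
    lam c ⊓ lam d = ⊥ ↔ c.1 * d.1 = ⊥ := by
  rw [← lam_mul, lam_eq_bot_iff hA]; rfl

theorem lam_sup_lam_eq_top_iff {c d : K A} : lam c ⊔ lam d = ⊤ ↔ c.1 ⊔ d.1 = ⊤ := by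
  rw [← lam_sup, lam_eq_top_iff]; rfl

theorem isConormalLattice_retic_iff (hA : IsSemiprime A) :
    IsConormalLattice (Retic A) ↔ IsPF A := by
  rw [isPF_iff]
  constructor
  · intro h c d hc hd hcd
    obtain ⟨s, t, hs, ht, hst⟩ := h (lam ⟨c, hc⟩) (lam ⟨d, hd⟩) ((lam_inf_lam_eq_bot_iff hA).2 hcd)
    obtain ⟨s, rfl⟩ := exists_lam_eq s
    obtain ⟨t, rfl⟩ := exists_lam_eq t
    exact top_le_iff.1 ((lam_sup_lam_eq_top_iff.1 hst).ge.trans (sup_le_sup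
      (le_perp_iff.2 ((lam_inf_lam_eq_bot_iff hA).1 hs))
      (le_perp_iff.2 ((lam_inf_lam_eq_bot_iff hA).1 ht))))
  · intro h x y hxy
    obtain ⟨c, rfl⟩ := exists_lam_eq x
    obtain ⟨d, rfl⟩ := exists_lam_eq y
    have hsup := h c.1 d.1 c.2 d.2 ((lam_inf_lam_eq_bot_iff hA).1 hxy)
    -- `c^⊥` and `d^⊥` need not be compact, hence need not come from `L(A)`. Compactness of `1`
    -- replaces them by compact elements below them that still join to `1`.
    have hdir : DirectedOn (· ≤ ·)
        {z : A | ∃ s t, IsCompactElement s ∧ IsCompactElement t ∧ s ≤ perp c.1 ∧ t ≤ perp d.1 ∧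
          z = s ⊔ t} := by
      rintro _ ⟨s, t, hs, ht, hsc, htd, rfl⟩ _ ⟨s', t', hs', ht', hsc', htd', rfl⟩
      exact ⟨_, ⟨s ⊔ s', t ⊔ t', isCompact_sup hs hs', isCompact_sup ht ht', sup_le hsc hsc',
        sup_le htd htd', rfl⟩, sup_le_sup le_sup_left le_sup_left,
        sup_le_sup le_sup_right le_sup_right⟩
    obtain ⟨_, ⟨s, t, hs, ht, hsc, htd, rfl⟩, hst⟩ :=
      (CompleteLattice.isCompactElement_iff_le_of_directed_sSup_le A ⊤).1 IsCoherent.isCompact_top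
        _ (by exact ⟨⊥ ⊔ ⊥, ⊥, ⊥, isCompact_bot, isCompact_bot, bot_le, bot_le, rfl⟩) hdir
        (by
          rw [← hsup]
          refine sup_le ?_ ?_ <;>
            refine le_iff_compact_le_imp.2 fun k hk hkc => le_sSup ?_
          · exact ⟨k, ⊥, hk, isCompact_bot, hkc, bot_le, by simp⟩
          · exact ⟨⊥, k, isCompact_bot, hk, bot_le, hkc, by simp⟩)
    exact ⟨lam ⟨s, hs⟩, lam ⟨t, ht⟩, (lam_inf_lam_eq_bot_iff hA).2 (le_perp_iff.1 hsc),
      (lam_inf_lam_eq_bot_iff hA).2 (le_perp_iff.1 htd),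
      lam_sup_lam_eq_top_iff.2 (top_le_iff.1 hst)⟩

theorem isStoneLattice_retic_iff (hA : IsSemiprime A) :
    IsStoneLattice (Retic A) ↔ IsPP A := by
  constructor
  · intro h c hc
    obtain ⟨e, ⟨f, hef⟩, he⟩ := h (lam ⟨c, hc⟩)
    obtain ⟨e, rfl⟩ := exists_lam_eq e
    obtain ⟨f, rfl⟩ := exists_lam_eq f
    have hmul := (lam_inf_lam_eq_bot_iff hA).1 hef.inf_eq_bot
    have hsup := lam_sup_lam_eq_top_iff.1 hef.sup_eq_top
    have hmem : ∀ d : K A, c * d.1 = ⊥ ↔ lam d ≤ lam e := fun d =>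
      (lam_inf_lam_eq_bot_iff hA).symm.trans (Set.ext_iff.1 he (lam d))
    have hperp : perp c = e.1 := by
      refine le_antisymm (le_iff_compact_le_imp.2 fun d hd hdc => ?_)
        (le_perp_iff.2 ((hmem e).2 le_rfl))
      obtain ⟨n, -, hn⟩ := (hmem ⟨d, hd⟩).1 (le_perp_iff.1 hdc)
      -- From `d^n ≤ e` one gets `d^n f ≤ ef = 0`, so `df = 0` and therefore `d ≤ e`, the power
      -- being gone.
      refine le_of_mul_eq_bot hsup (mul_eq_bot_of_pow_mul_eq_bot hA n ?_)
      rw [← le_bot_iff, ← hmul]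
      exact mul_le_mul_left hn f.1
    rw [hperp]
    exact ⟨f.1, isCompl_of_mul_eq_bot hA hsup hmul⟩
  · intro h x
    obtain ⟨c, rfl⟩ := exists_lam_eq x
    obtain ⟨f, hf⟩ := h c.1 c.2
    have hmul := mul_eq_bot_of_isCompl hf
    -- Complemented elements are compact, so `c^⊥` and its complement have images in `L(A)`.
    have he := isCompact_of_sup_eq_top hf.sup_eq_top hmul
    have hfc : IsCompactElement f :=
      isCompact_of_sup_eq_top (by rw [sup_comm, hf.sup_eq_top]) (by rw [mul_comm, hmul])
    refine ⟨lam ⟨perp c.1, he⟩, ⟨lam ⟨f, hfc⟩, IsCompl.of_eq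
      ((lam_inf_lam_eq_bot_iff hA).2 hmul) (lam_sup_lam_eq_top_iff.2 hf.sup_eq_top)⟩, ?_⟩
    ext y
    obtain ⟨d, rfl⟩ := exists_lam_eq y
    refine (lam_inf_lam_eq_bot_iff hA).trans (Iff.trans ?_ lam_le_lam.symm)
    constructor
    · exact fun hcd => ReticLE.of_le (le_perp_iff.2 hcd)
    · rintro ⟨n, -, hn⟩
      rw [mul_comm]
      refine mul_eq_bot_of_pow_mul_eq_bot hA n ?_
      rw [mul_comm]
      exact le_perp_iff.1 hn

end Retic

/-! ### The minimal spectrum and the spectral and flat topologies. -/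

section Topology

open Topology

variable {A : Type u} [CommMonoid A] [CompleteLattice A] [IsQuantale A] [IsCoherent A]

theorem isClosed_specZ_iff {s : Set (SpecZ A)} :
    IsClosed s ↔ ∃ a : A, {p : SpecZ A | a ≤ p.1} = s := by
  rw [← isOpen_compl_iff]
  change sᶜᶜ ∈ Set.range _ ↔ _
  rw [compl_compl]
  rfl

theorem isClosed_specZ_le (a : A) : IsClosed {p : SpecZ A | a ≤ p.1} :=
  isClosed_specZ_iff.2 ⟨a, rfl⟩

theorem isOpen_specF_le {c : A} (hc : IsCompactElement c) : IsOpen {p : SpecF A | c ≤ p.1} :=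
  .basic _ ⟨c, hc, rfl⟩

/-- Every `V(a)` is the intersection of the `V(c)` with `c ≤ a` compact. -/
theorem continuous_specZ_iff {X : Type v} [TopologicalSpace X] {f : X → SpecZ A} :
    Continuous f ↔ ∀ c : A, IsCompactElement c → IsClosed {x | c ≤ (f x).1} := by
  refine ⟨fun h c _ => (isClosed_specZ_le c).preimage h, fun h => continuous_iff_isClosed.2 ?_⟩
  intro s hs
  obtain ⟨a, rfl⟩ := isClosed_specZ_iff.1 hs
  have : f ⁻¹' {p : SpecZ A | a ≤ p.1} =
      ⋂ (c : A) (_ : IsCompactElement c ∧ c ≤ a), {x | c ≤ (f x).1} := by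
    ext x
    simp only [Set.mem_preimage, Set.mem_ofPred_eq, Set.mem_iInter]
    exact le_iff_compact_le_imp.trans ⟨fun h c hc => h c hc.1 hc.2, fun h c hc hca => h c ⟨hc, hca⟩⟩
  rw [this]
  exact isClosed_iInter fun c => isClosed_iInter fun hc => h c hc.1

instance : CompactSpace (SpecZ A) := by
  refine ⟨isCompact_of_finite_subfamily_closed fun t ht hempty => ?_⟩
  choose a ha using fun i => isClosed_specZ_iff.1 (ht i)
  have htop : ⨆ i, a i = ⊤ := by
    by_contra hne
    obtain ⟨p, hp, hle⟩ := exists_isMPrime_ge hne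
    have : (⟨p, hp⟩ : SpecZ A) ∈ Set.univ ∩ ⋂ i, t i := by
      refine ⟨trivial, Set.mem_iInter.2 fun i => ?_⟩
      rw [← ha i]
      exact (le_iSup a i).trans hle
    rwa [hempty] at this
  obtain ⟨u, hu⟩ := CompleteLattice.IsCompactElement.exists_finset_of_le_iSup A
    IsCoherent.isCompact_top a htop.ge
  refine ⟨u, Set.eq_empty_iff_forall_notMem.2 fun p ⟨_, hp⟩ => p.2.1.not_ge (hu.trans ?_)⟩
  refine iSup₂_le fun i hi => ?_
  have := Set.mem_iInter₂.1 hp i hi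
  rwa [← ha i] at this

theorem isClosed_minZ_le (a : A) : IsClosed {q : MinZ A | a ≤ q.1.1} :=
  (isClosed_specZ_le a).preimage continuous_subtype_val

theorem isOpen_minZ_not_le (a : A) : IsOpen {q : MinZ A | ¬ a ≤ q.1.1} :=
  (isClosed_minZ_le a).isOpen_compl

theorem isOpen_minZ_le (hA : IsSemiprime A) {c : A} (hc : IsCompactElement c) :
    IsOpen {q : MinZ A | c ≤ q.1.1} := by
  have : {q : MinZ A | c ≤ q.1.1} = {q : MinZ A | ¬ perp c ≤ q.1.1} :=
    Set.ext fun q => q.2.le_iff_not_perp_le hA hc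
  rw [this]
  exact isOpen_minZ_not_le _

theorem exists_isClopen_minZ (hA : IsSemiprime A) {p q : MinZ A} (hpq : p ≠ q) :
    ∃ U : Set (MinZ A), IsClopen U ∧ p ∈ U ∧ q ∈ Uᶜ := by
  have hle : ¬ p.1.1 ≤ q.1.1 := fun h =>
    hpq (Subtype.ext (Subtype.ext (le_antisymm h (q.2.2 p.2.1 h))))
  obtain ⟨c, hc, hcp, hcq⟩ := exists_compact_le_not_le hle
  exact ⟨{q | c ≤ q.1.1}, ⟨isClosed_minZ_le c, isOpen_minZ_le hA hc⟩, hcp, hcq⟩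

theorem isBooleanSpace_minZ_iff (hA : IsSemiprime A) :
    IsBooleanSpace (MinZ A) ↔ CompactSpace (MinZ A) := by
  refine ⟨fun h => h.1, fun h => ⟨h, ?_, ?_⟩⟩
  · refine ⟨fun p q hpq => ?_⟩
    obtain ⟨U, hU, hp, hq⟩ := exists_isClopen_minZ hA hpq
    exact ⟨U, Uᶜ, hU.isOpen, hU.compl.isOpen, hp, hq, disjoint_compl_right⟩
  · have : TotallySeparatedSpace (MinZ A) := by
      refine totallySeparatedSpace_iff_exists_isClopen.2 fun p q hpq => ?_
      obtain ⟨U, hU, hp, hq⟩ := exists_isClopen_minZ hA hpq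
      exact ⟨U, hU, hp, hq⟩
    infer_instance

/-- A minimal `m`-prime above `c` is not above `c^⊥`, so it misses some compact `d` with `cd = 0`.
These `d` form a directed family, so by compactness one of them is missed by all minimal `m`-primes
above `c`. Every minimal `m`-prime is then above `c^⊥` or `d^⊥`, whence `c^⊥ ∧ d^⊥ = 0`. -/
theorem IsPF.isPP (hA : IsSemiprime A) (h : IsPF A) [CompactSpace (MinZ A)] : IsPP A := by
  intro c hc
  obtain ⟨⟨d, hd, hcd⟩, hsub⟩ := (isClosed_minZ_le c).isCompact.elim_directed_cover
    (ι := {d : A // IsCompactElement d ∧ c * d = ⊥}) (hι := ⟨⟨⊥, isCompact_bot, Quantale.mul_bot⟩⟩)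
    (fun d => {q : MinZ A | ¬ d.1 ≤ q.1.1}) (fun d => isOpen_minZ_not_le _)
    (fun q hq => by
      obtain ⟨d, hd, hdc, hdq⟩ := exists_compact_le_not_le ((q.2.le_iff_not_perp_le hA hc).1 hq)
      exact Set.mem_iUnion.2 ⟨⟨d, hd, le_perp_iff.1 hdc⟩, hdq⟩)
    (fun d e => ⟨⟨d.1 ⊔ e.1, isCompact_sup d.2.1 e.2.1, by
        rw [Quantale.mul_sup_distrib, d.2.2, e.2.2, sup_bot_eq]⟩,
      fun q hq hle => hq (le_sup_left.trans hle), fun q hq hle => hq (le_sup_right.trans hle)⟩)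
  refine ⟨perp d, IsCompl.of_eq (eq_bot_of_forall_isMinimalMPrime hA fun p hp => ?_)
    (isPF_iff.1 h c d hc hd hcd)⟩
  by_cases hcp : c ≤ p
  · exact inf_le_right.trans (hp.1.perp_le (hsub (show (⟨⟨p, hp.1⟩, hp⟩ : MinZ A) ∈ _ from hcp)))
  · exact inf_le_left.trans (hp.1.perp_le hcp)

/-- A minimal `m`-prime element below a given one. -/
noncomputable def minBelow (p : {p : A // IsMPrime p}) : MinZ A :=
  ⟨⟨_, p.2.exists_isMinimalMPrime_le.choose_spec.1.1⟩,
    p.2.exists_isMinimalMPrime_le.choose_spec.1⟩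

theorem minBelow_le (p : {p : A // IsMPrime p}) : (minBelow p).1.1 ≤ p.1 :=
  p.2.exists_isMinimalMPrime_le.choose_spec.2

theorem minBelow_self (q : MinZ A) : minBelow q.1 = q :=
  Subtype.ext (Subtype.ext (le_antisymm (minBelow_le q.1)
    (q.2.2 (minBelow q.1).2.1 (minBelow_le q.1))))

/-- Complemented elements do not distinguish an `m`-prime element from one below it. -/
theorem IsMPrime.le_iff_of_isCompl {p q e f : A} (hp : IsMPrime p) (hq : IsMPrime q) (hqp : q ≤ p)
    (h : IsCompl e f) : e ≤ p ↔ ¬ f ≤ q := by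
  refine ⟨fun hep hfq => hp.1.not_ge (h.sup_eq_top.ge.trans (sup_le hep (hfq.trans hqp))),
    fun hf => ((hq.2 e f ((mul_eq_bot_of_isCompl h).trans_le bot_le)).resolve_right hf).trans hqp⟩

/-- The first description exhibits a spectrally closed set, the second the complement of a flat open
one, as needed for the two continuity statements. -/
theorem le_minBelow_iff (hA : IsSemiprime A) {c f : A} (hc : IsCompactElement c)
    (hf : IsCompl (perp c) f) (p : {p : A // IsMPrime p}) :
    (c ≤ (minBelow p).1.1 ↔ f ≤ p.1) ∧ (c ≤ (minBelow p).1.1 ↔ ¬ perp c ≤ p.1) := by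
  have h := (minBelow p).2.le_iff_not_perp_le hA hc
  have h₁ := p.2.le_iff_of_isCompl (minBelow p).1.2 (minBelow_le p) hf.symm
  have h₂ := p.2.le_iff_of_isCompl p.2 le_rfl hf.symm
  exact ⟨h.trans h₁.symm, h.trans (h₁.symm.trans h₂)⟩

theorem IsPP.continuous_minBelow_specZ (hA : IsSemiprime A) (h : IsPP A) :
    Continuous fun p : SpecZ A => minBelow p := by
  refine Continuous.subtype_mk (continuous_specZ_iff.2 fun c hc => ?_) _
  obtain ⟨f, hf⟩ := h c hc
  have : {p : SpecZ A | c ≤ (minBelow p).1.1} = {p : SpecZ A | f ≤ p.1} :=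
    Set.ext fun p => (le_minBelow_iff hA hc hf p).1
  exact this ▸ isClosed_specZ_le f

theorem IsPP.continuous_minBelow_specF (hA : IsSemiprime A) (h : IsPP A) :
    Continuous fun p : SpecF A => minBelow p := by
  refine Continuous.subtype_mk (continuous_specZ_iff.2 fun c hc => ?_) _
  obtain ⟨f, hf⟩ := h c hc
  have : {p : SpecF A | c ≤ (minBelow p).1.1} = {p : SpecF A | perp c ≤ p.1}ᶜ :=
    Set.ext fun p => (le_minBelow_iff hA hc hf p).2
  exact this ▸ (isOpen_specF_le
    (isCompact_of_sup_eq_top hf.sup_eq_top (mul_eq_bot_of_isCompl hf))).isClosed_compl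

theorem IsPP.compactSpace_minZ (hA : IsSemiprime A) (h : IsPP A) : CompactSpace (MinZ A) :=
  (show Function.Surjective fun p : SpecZ A => minBelow p from
    fun q => ⟨q.1, minBelow_self q⟩).compactSpace (h.continuous_minBelow_specZ hA)

/-- The basic sets `V(c)` are upward closed, and this passes to intersections and unions. -/
theorem mem_of_le_of_isOpen_specF {U : Set (SpecF A)} (hU : IsOpen U) {p q : SpecF A}
    (hpq : p.1 ≤ q.1) (hp : p ∈ U) : q ∈ U := by
  induction hU with
  | basic s hs =>
    obtain ⟨c, -, rfl⟩ := hs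
    exact le_trans (show c ≤ p.1 from hp) hpq
  | univ => trivial
  | inter s t _ _ ihs iht => exact ⟨ihs hp.1, iht hp.2⟩
  | sUnion S _ ih =>
    obtain ⟨s, hs, hps⟩ := hp
    exact ⟨s, hs, ih s hs hps⟩

/-- The inclusion of the minimal spectrum into the spectrum with the flat topology. -/
def MinZ.toSpecF (q : MinZ A) : SpecF A := ⟨q.1.1, q.1.2⟩

theorem MinZ.continuous_toSpecF (hA : IsSemiprime A) :
    Continuous (MinZ.toSpecF : MinZ A → SpecF A) := by
  refine continuous_generateFrom_iff.2 ?_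
  rintro _ ⟨c, hc, rfl⟩
  exact isOpen_minZ_le hA hc

theorem IsPP.normalSpace_specF (hA : IsSemiprime A) (h : IsPP A) : NormalSpace (SpecF A) := by
  obtain ⟨_, _, _⟩ := (isBooleanSpace_minZ_iff hA).2 (h.compactSpace_minZ hA)
  refine ⟨fun F G hF hG hFG => ?_⟩
  -- Flat closed sets are downward closed, so `C` contains the chosen minimal `m`-prime below each
  -- of its points. Separating the traces of `F` and `G` on `Min_Z(A)` therefore suffices.
  have hsub : ∀ {C : Set (SpecF A)}, IsClosed C →
      C ⊆ (fun p : SpecF A => minBelow p) ⁻¹' (MinZ.toSpecF ⁻¹' C) :=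
    fun hC p hp => by_contra fun hn =>
      mem_of_le_of_isOpen_specF hC.isOpen_compl (minBelow_le p) hn hp
  have hι := MinZ.continuous_toSpecF hA
  exact ((normal_separation (hF.preimage hι) (hG.preimage hι) (hFG.preimage _)).preimage
    (h.continuous_minBelow_specF hA)).mono (hsub hF) (hsub hG)

theorem IsMinimalMPrime.isClosed_singleton_specF {q : SpecF A} (hq : IsMinimalMPrime q.1) :
    IsClosed {q} := by
  rw [← isOpen_compl_iff, isOpen_iff_forall_mem_open]
  intro p hp
  have hpq : ¬ p.1 ≤ q.1 := fun h => hp (Subtype.ext (le_antisymm h (hq.2 p.2 h)))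
  obtain ⟨c, hc, hcp, hcq⟩ := exists_compact_le_not_le hpq
  refine ⟨_, ?_, isOpen_specF_le hc, hcp⟩
  rintro r hr rfl
  exact hcq hr

/-- Disjoint flat neighbourhoods of two minimal `m`-primes below `p` would both contain `p`. -/
theorem isMP_of_normalSpace_specF [NormalSpace (SpecF A)] : IsMP A := by
  intro p hp
  obtain ⟨q, hq, hqp⟩ := hp.exists_isMinimalMPrime_le
  refine ⟨q, ⟨hq, hqp⟩, fun r ⟨hr, hrp⟩ => ?_⟩
  by_contra hne
  obtain ⟨U, V, hU, hV, hqU, hrV, hUV⟩ := normal_separation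
    (IsMinimalMPrime.isClosed_singleton_specF (q := ⟨q, hq.1⟩) hq)
    (IsMinimalMPrime.isClosed_singleton_specF (q := ⟨r, hr.1⟩) hr)
    (Set.disjoint_singleton.2 fun h => hne (congrArg Subtype.val h).symm)
  exact Set.disjoint_left.1 hUV
    (mem_of_le_of_isOpen_specF (q := ⟨p, hp⟩) hU hqp (hqU rfl))
    (mem_of_le_of_isOpen_specF (q := ⟨p, hp⟩) hV hrp (hrV rfl))

end Topology

/-! ### Prime ideals of the reticulation. -/

section PrimeIdeals

open Order

variable {A : Type u} [CommMonoid A] [CompleteLattice A] [IsQuantale A] [IsCoherent A]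

/-- The ideal of the reticulation that corresponds to an `m`-prime element. -/
def reticIdeal (p : {p : A // IsMPrime p}) : Ideal (Retic A) :=
  IsIdeal.toIdeal (I := {x | ∃ c : K A, lam c = x ∧ c.1 ≤ p.1})
    { IsLowerSet := by
        rintro _ y hyx ⟨c, rfl, hc⟩
        obtain ⟨d, rfl⟩ := exists_lam_eq y
        obtain ⟨n, hn, h⟩ := lam_le_lam.1 hyx
        exact ⟨d, rfl, p.2.le_of_pow_le hn (h.trans hc)⟩
      Nonempty := ⟨_, ⟨⊥, isCompact_bot⟩, rfl, bot_le⟩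
      Directed := by
        rintro _ ⟨c, rfl, hc⟩ _ ⟨d, rfl, hd⟩
        exact ⟨_, ⟨c.sup d, rfl, sup_le hc hd⟩, le_sup_left (a := lam c) (b := lam d),
          le_sup_right (a := lam c) (b := lam d)⟩ }

theorem lam_mem_reticIdeal {p : {p : A // IsMPrime p}} {c : K A} :
    lam c ∈ reticIdeal p ↔ c.1 ≤ p.1 := by
  refine ⟨?_, fun h => ⟨c, rfl, h⟩⟩
  rintro ⟨d, hdc, hd⟩
  obtain ⟨n, hn, h⟩ := lam_le_lam.1 hdc.ge
  exact p.2.le_of_pow_le hn (h.trans hd)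

theorem reticIdeal_isPrime (p : {p : A // IsMPrime p}) : (reticIdeal p).IsPrime := by
  have : (reticIdeal p).IsProper := Ideal.isProper_of_notMem (p := (⊤ : Retic A)) fun h =>
    p.2.1.not_ge (lam_mem_reticIdeal.1 h)
  refine Ideal.IsPrime.of_mem_or_mem fun {x y} hxy => ?_
  obtain ⟨c, rfl⟩ := exists_lam_eq x
  obtain ⟨d, rfl⟩ := exists_lam_eq y
  rw [← lam_mul, lam_mem_reticIdeal] at hxy
  rw [lam_mem_reticIdeal, lam_mem_reticIdeal]
  exact p.2.2 _ _ hxy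

/-- The element of the quantale that corresponds to an ideal of the reticulation. -/
def idealSup (I : Ideal (Retic A)) : A := sSup {c | ∃ hc : IsCompactElement c, lam ⟨c, hc⟩ ∈ I}

/-- The join is directed because `I` is closed under joins, so a compact element below it is below
one of the joined elements. -/
theorem le_idealSup_iff {I : Ideal (Retic A)} {c : K A} : c.1 ≤ idealSup I ↔ lam c ∈ I := by
  refine ⟨fun h => ?_, fun h => le_sSup ⟨c.2, h⟩⟩
  obtain ⟨d, ⟨hd, hdI⟩, hcd⟩ := (CompleteLattice.isCompactElement_iff_le_of_directed_sSup_le A _).1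
    c.2 _ (by exact ⟨⊥, isCompact_bot, I.bot_mem⟩)
    (by
      rintro a ⟨ha, haI⟩ b ⟨hb, hbI⟩
      exact ⟨a ⊔ b, ⟨isCompact_sup ha hb, I.sup_mem haI hbI⟩, le_sup_left, le_sup_right⟩) h
  exact I.lower (a := lam ⟨d, hd⟩) (ReticLE.of_le hcd) hdI

theorem isMPrime_idealSup {I : Ideal (Retic A)} (hI : I.IsPrime) : IsMPrime (idealSup I) := by
  constructor
  · refine lt_top_iff_ne_top.2 fun h => hI.toIsProper.ne_univ (Set.eq_univ_of_forall fun x => ?_)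
    exact I.lower le_top (le_idealSup_iff (c := ⟨⊤, IsCoherent.isCompact_top⟩).1 h.ge)
  · intro a b hab
    by_contra! h
    obtain ⟨c, hc, hca, hcI⟩ := exists_compact_le_not_le h.1
    obtain ⟨d, hd, hdb, hdI⟩ := exists_compact_le_not_le h.2
    have := le_idealSup_iff (c := K.mul ⟨c, hc⟩ ⟨d, hd⟩).1 ((mul_le_mul' hca hdb).trans hab)
    rcases hI.mem_or_mem (x := lam ⟨c, hc⟩) (y := lam ⟨d, hd⟩) this with h | h
    · exact hcI (le_idealSup_iff.2 h)
    · exact hdI (le_idealSup_iff.2 h)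

/-- The spectrum of a coherent quantale is homeomorphic to that of its reticulation. -/
def specHomeomorph : SpecZ A ≃ₜ SpecIdZ (Retic A) where
  toFun p := ⟨reticIdeal p, reticIdeal_isPrime p⟩
  invFun I := ⟨idealSup I.1, isMPrime_idealSup I.2⟩
  left_inv p := Subtype.ext <| by
    have h : ∀ c (hc : IsCompactElement c), c ≤ idealSup (reticIdeal p) ↔ c ≤ p.1 := fun c hc =>
      (le_idealSup_iff (c := ⟨c, hc⟩)).trans lam_mem_reticIdeal
    exact le_antisymm (le_iff_compact_le_imp.2 fun c hc => (h c hc).1)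
      (le_iff_compact_le_imp.2 fun c hc => (h c hc).2)
  right_inv I := Subtype.ext <| SetLike.ext fun x => by
    obtain ⟨c, rfl⟩ := exists_lam_eq x
    exact lam_mem_reticIdeal.trans le_idealSup_iff
  continuous_toFun := by
    refine continuous_generateFrom_iff.2 ?_
    rintro _ ⟨x, rfl⟩
    obtain ⟨c, rfl⟩ := exists_lam_eq x
    convert (isClosed_specZ_le c.1).isOpen_compl using 1
    exact Set.ext fun p => not_congr lam_mem_reticIdeal
  continuous_invFun := by
    refine continuous_specZ_iff.2 fun c hc => ?_
    refine ⟨.basic _ ⟨lam ⟨c, hc⟩, ?_⟩⟩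
    exact Set.ext fun I => not_congr (le_idealSup_iff (c := ⟨c, hc⟩))

/-- The homeomorphism preserves and reflects the order, which is what makes it restrict to the
minimal spectra. -/
theorem specHomeomorph_le_iff {p q : SpecZ A} :
    (specHomeomorph p).1 ≤ (specHomeomorph q).1 ↔ p.1 ≤ q.1 := by
  refine ⟨fun h => le_iff_compact_le_imp.2 fun c hc hcp => ?_, fun h x hx => ?_⟩
  · exact lam_mem_reticIdeal.1 (h (lam_mem_reticIdeal (c := ⟨c, hc⟩).2 hcp))
  · obtain ⟨c, rfl⟩ := exists_lam_eq x
    exact lam_mem_reticIdeal.2 ((lam_mem_reticIdeal.1 hx).trans h)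

theorem isMinimalMPrime_iff_minimal_specHomeomorph (p : SpecZ A) :
    IsMinimalMPrime p.1 ↔
      Minimal (fun I : Ideal (Retic A) => I.IsPrime) (specHomeomorph p).1 := by
  constructor
  · refine fun h => ⟨(specHomeomorph p).2, fun I hI hle => ?_⟩
    obtain ⟨q, hq⟩ := specHomeomorph.surjective (⟨I, hI⟩ : SpecIdZ (Retic A))
    obtain rfl : (specHomeomorph q).1 = I := congrArg Subtype.val hq
    exact specHomeomorph_le_iff.2 (h.2 q.2 (specHomeomorph_le_iff.1 hle))
  · exact fun h => ⟨p.2, fun q hq hle => (specHomeomorph_le_iff (q := ⟨q, hq⟩)).1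
      (h.2 (specHomeomorph ⟨q, hq⟩).2 ((specHomeomorph_le_iff (p := ⟨q, hq⟩)).2 hle))⟩

theorem compactSpace_minIdZ_retic_iff :
    CompactSpace (MinIdZ (Retic A)) ↔ CompactSpace (MinZ A) := by
  have e : MinZ A ≃ₜ MinIdZ (Retic A) :=
    specHomeomorph.subtype isMinimalMPrime_iff_minimal_specHomeomorph
  exact ⟨fun _ => e.symm.compactSpace, fun _ => e.compactSpace⟩

end PrimeIdeals

end CohQuantale

theorem theorem8p5 {A : Type u} [CommMonoid A] [CompleteLattice A] [IsQuantale A]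
    [CohQuantale.IsCoherent A] (hA : CohQuantale.IsSemiprime A) :
    List.TFAE
      [CohQuantale.IsPP A,
        CohQuantale.IsStoneLattice (CohQuantale.Retic A),
        CohQuantale.IsConormalLattice (CohQuantale.Retic A) ∧
          CompactSpace (CohQuantale.MinIdZ (CohQuantale.Retic A)),
        CohQuantale.IsPF A ∧ CompactSpace (CohQuantale.MinZ A),
        CohQuantale.IsPF A ∧ CohQuantale.IsBooleanSpace (CohQuantale.MinZ A),
        CohQuantale.IsMP A ∧ CohQuantale.IsBooleanSpace (CohQuantale.MinZ A),
        NormalSpace (CohQuantale.SpecF A) ∧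
          CohQuantale.IsBooleanSpace (CohQuantale.MinZ A)] := by
  tfae_have 1 ↔ 2 := (CohQuantale.isStoneLattice_retic_iff hA).symm
  tfae_have 3 ↔ 4 := and_congr (CohQuantale.isConormalLattice_retic_iff hA)
    CohQuantale.compactSpace_minIdZ_retic_iff
  tfae_have 4 ↔ 5 := and_congr Iff.rfl (CohQuantale.isBooleanSpace_minZ_iff hA).symm
  tfae_have 1 → 4 := fun h => ⟨h.isPF, h.compactSpace_minZ hA⟩
  tfae_have 4 → 1 := fun ⟨h, _⟩ => h.isPP hA
  tfae_have 5 ↔ 6 := and_congr ⟨fun h => h.isMP hA, fun h => h.isPF hA⟩ Iff.rfl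
  tfae_have 1 → 7 := fun h => ⟨h.normalSpace_specF hA,
    (CohQuantale.isBooleanSpace_minZ_iff hA).2 (h.compactSpace_minZ hA)⟩
  tfae_have 7 → 6 := fun ⟨_, h⟩ => ⟨CohQuantale.isMP_of_normalSpace_specF, h⟩
  tfae_finish
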